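/- Let $n\ge 0$, $T>0$, and let $\Gamma(t)\subset\mathbb{R}^{n+1}$, $t\in[0,T]$, be compact smooth embedded hypersurfaces without boundary. Let $\Phi:\Gamma(0)\times[0,T]\to\mathbb{R}^{n+1}$ be a smooth map with $\Phi(\cdot,0)=\mathrm{Id}$ such that $\Phi(\cdot,t):\Gamma(0)\to\Gamma(t)$ is a diffeomorphism for every $t\in[0,T]$. Write $v=\partial_t\Phi\circ\Phi^{-1}$ for the velocity of the material points and $G_T=\bigcup_{t\in(0,T)}\Gamma(t)\times\{t\}$ for the space-time surface. For a function $g$ on $\Gamma(t)$ with unit normal $\nu$, let $\nabla_\Gamma g=\nabla\bar g-(\nabla\bar g\cdot\nu)\nu=(\underline D_1g,\dots,\underline D_{n+1}g)$ be the tangential gradient ($\bar g$ any extension of $g$ to a neighbourhood); let $\nabla_\Gamma\cdot X=\sum_j\underline D_jX_j$ be the surface divergence; and for $g:G_T\to\mathbb{R}$ let $\dot g=\partial_tg+v\cdot\nabla g$ be the material derivative. Let $f=f((x,t),s)\in\mathbb{R}^{n+1}$ be a smooth flux on $G_T\times\mathbb{R}$ such that $f((x,t),s)$ is tangent to $\Gamma(t)$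 at $x$ and $\nabla_\Gamma\cdot f((\cdot,t),s)=0$ on $\Gamma(t)$ for all fixed $t\in(0,T)$ and $s\in\mathbb{R}$. Let $B=B(x,t)$ be a smooth family on $G_T$ of symmetric $(n+1)\times(n+1)$ matrices with $B\nu=0$ which map the tangent space of $\Gamma(t)$ at $x$ into itself and are positive definite on it. Let $c_0\ge 0$. Then there is a constant $c$, depending only on these data (the moving surface, $T$, $f$, $B$ and $c_0$), such that for every $\varepsilon\in(0,1]$, every initial function $u_{0\varepsilon}$ on $\Gamma(0)$ with $\|u_{0\varepsilon}\|_{L^\infty(\Gamma(0))}\le c_0$, and every smooth solution $u_\varepsilon$ (smooth on $G_T$ and continuous up to $t=0$) of $$\dot u_\varepsilon+u_\varepsilon\nabla_\Gamma\cdot v+\nabla_\Gamma\cdot\big(f(\cdot,u_\varepsilon)\big)-\varepsilon\nabla_\Gamma\cdot(B\nabla_\Gamma u_\varepsilon)=0\ \text{ on } G_T,\qquad u_\varepsilon(\cdot,0)=u_{0\varepsilon}\ \text{ on }\Gamma(0),$$ where $\nabla_\Gamma\cdot(f(\cdot,u_\varepsilon))$ is the total divergence of $x\mapsto f((x,t),u_\varepsilon(x,t))$,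 one has $$\sup_{t\in(0,T)}\|u_\varepsilon(\cdot,t)\|_{L^\infty(\Gamma(t))}\le c .$$ In particular $c$ does not depend on $\varepsilon$. -/

import Mathlib

open Set Topology MeasureTheory
open scoped ContDiff ENNReal NNReal

noncomputable section

/-- The ambient space `ℝ^{n+1}` with its Euclidean inner product. -/
abbrev Amb (n : ℕ) : Type := EuclideanSpace ℝ (Fin (n + 1))

/-- A function is smooth on an arbitrary subset `S` of a normed space if near every point of `S`
it agrees on `S` with a `C^∞` function defined on an open neighbourhood of that point. -/
def SmoothOnSet {V W : Type*} [NormedAddCommGroup V] [NormedSpace ℝ V]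
    [NormedAddCommGroup W] [NormedSpace ℝ W] (g : V → W) (S : Set V) : Prop :=
  ∀ x ∈ S, ∃ U : Set V, IsOpen U ∧ x ∈ U ∧
    ∃ G : V → W, ContDiffOn ℝ ∞ G U ∧ EqOn G g (U ∩ S)

/-- A closed (compact, without boundary) smooth embedded hypersurface of `ℝ^{n+1}`: a compact set
which is locally the zero set of a smooth function with non-vanishing differential. -/
structure IsClosedSmoothHypersurface {n : ℕ} (S : Set (Amb n)) : Prop where
  isCompact : IsCompact S
  exists_defining : ∀ x ∈ S, ∃ U : Set (Amb n), IsOpen U ∧ x ∈ U ∧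
    ∃ φ : Amb n → ℝ, ContDiffOn ℝ ∞ φ U ∧ (∀ y ∈ U, fderiv ℝ φ y ≠ 0) ∧
      S ∩ U = {y ∈ U | φ y = 0}

/-- The tangent space of `S` at `x`, as a linear subspace of `ℝ^{n+1}`. Its orthogonal complement
is the line spanned by the unit normal `ν(x)` when `S` is a smooth hypersurface. -/
def tangentSpaceAt {n : ℕ} (S : Set (Amb n)) (x : Amb n) : Submodule ℝ (Amb n) :=
  Submodule.span ℝ (tangentConeAt ℝ S x)

/-- The tangential gradient `∇_S g = ∇ḡ - (∇ḡ · ν) ν`: the orthogonal projection onto the tangent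
space of a gradient of `g` along `S`. It is independent of the choice of that gradient, see
`tangentialGradient_eq_of_extension`. -/
def tangentialGradient {n : ℕ} (S : Set (Amb n)) (g : Amb n → ℝ) (x : Amb n) : Amb n :=
  (tangentSpaceAt S x).starProjection (gradientWithin g S x)

/-- The tangential gradient may be computed with any extension `G` of `g`. -/
theorem tangentialGradient_eq_of_extension {n : ℕ} {S U : Set (Amb n)} {g G : Amb n → ℝ}
    {x : Amb n} (hx : x ∈ S) (hU : IsOpen U) (hxU : x ∈ U) (hG : DifferentiableAt ℝ G x)
    (hgG : EqOn G g (U ∩ S)) :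
    tangentialGradient S g x = (tangentSpaceAt S x).starProjection (gradient G x) := by
  have hG' : HasFDerivWithinAt g (fderiv ℝ G x) S x := by
    refine (hG.hasFDerivAt.hasFDerivWithinAt (s := S)).congr_of_eventuallyEq ?_
      (hgG ⟨hxU, hx⟩).symm
    filter_upwards [self_mem_nhdsWithin, mem_nhdsWithin_of_mem_nhds (hU.mem_nhds hxU)]
      with y hyS hyU using (hgG ⟨hyU, hyS⟩).symm
  have heq := hG'.differentiableWithinAt.hasFDerivWithinAt.unique_on hG'
  unfold tangentialGradient
  rw [← sub_eq_zero, ← map_sub, Submodule.starProjection_apply_eq_zero_iff]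
  rw [tangentSpaceAt, Submodule.mem_orthogonal']
  intro a ha
  induction ha using Submodule.span_induction with
  | mem a ha =>
    rw [inner_sub_left, sub_eq_zero]
    simpa [gradientWithin, gradient] using heq ha
  | zero => simp
  | add a b _ _ ha hb => rw [inner_add_right, ha, hb, add_zero]
  | smul r a _ ha => rw [inner_smul_right, ha, mul_zero]

/-- The surface divergence `∇_S · X = ∑_j D_j X_j`, where `D_j` is the `j`-th component of the
tangential gradient. -/
def surfaceDiv {n : ℕ} (S : Set (Amb n)) (X : Amb n → Amb n) (x : Amb n) : ℝ :=
  ∑ j : Fin (n + 1), tangentialGradient S (fun y => X y j) x j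

/-- The surface measure of an `n`-dimensional hypersurface: the `n`-dimensional Hausdorff
measure restricted to it. -/
def surfaceMeasure {n : ℕ} (S : Set (Amb n)) : Measure (Amb n) :=
  (μH[(n : ℝ)] : Measure (Amb n)).restrict S

/-- A smoothly moving closed smooth hypersurface `Γ(t)`, `t ∈ [0, T]`, in `ℝ^{n+1}`: the initial
surface `Γ(0)` is transported by a smooth map `Φ : Γ(0) × [0, T] → ℝ^{n+1}` such that `Φ(·, 0)` is
the identity and every `Φ(·, t) : Γ(0) → Γ(t)` is a diffeomorphism. -/
structure MovingHypersurface (n : ℕ) (T : ℝ) where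
  Γ : ℝ → Set (Amb n)
  Φ : Amb n × ℝ → Amb n
  hypersurface : ∀ t ∈ Icc 0 T, IsClosedSmoothHypersurface (Γ t)
  smooth_Φ : SmoothOnSet Φ (Γ 0 ×ˢ Icc 0 T)
  Φ_zero : ∀ y ∈ Γ 0, Φ (y, 0) = y
  bijOn : ∀ t ∈ Icc 0 T, BijOn (fun y => Φ (y, t)) (Γ 0) (Γ t)
  smooth_inv : ∀ t ∈ Icc 0 T,
    SmoothOnSet (Function.invFunOn (fun y => Φ (y, t)) (Γ 0)) (Γ t)

namespace MovingHypersurface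

variable {n : ℕ} {T : ℝ} (M : MovingHypersurface n T)

/-- The velocity `v = ∂_t Φ ∘ Φ⁻¹` of the material points, `v (x, t)` for `x ∈ Γ(t)`. -/
def velocity (p : Amb n × ℝ) : Amb n :=
  derivWithin (fun s => M.Φ (Function.invFunOn (fun y => M.Φ (y, p.2)) (M.Γ 0) p.1, s))
    (Icc 0 T) p.2

/-- The space-time surface `G_T = ⋃_{t ∈ (0, T)} Γ(t) × {t}`. -/
def spaceTime : Set (Amb n × ℝ) := {p | p.2 ∈ Ioo 0 T ∧ p.1 ∈ M.Γ p.2}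

/-- The space-time surface together with the initial surface, `⋃_{t ∈ [0, T)} Γ(t) × {t}`. -/
def spaceTimeWithInitial : Set (Amb n × ℝ) := {p | p.2 ∈ Ico 0 T ∧ p.1 ∈ M.Γ p.2}

/-- The material derivative `ġ = ∂_t g + v · ∇ g` of a function on `G_T`, that is, the derivative
of `g` along `G_T` in the space-time direction `(v, 1)`, which is tangent to `G_T`. -/
def materialDeriv (g : Amb n × ℝ → ℝ) (p : Amb n × ℝ) : ℝ :=
  fderivWithin ℝ g M.spaceTime p (M.velocity p, 1)

/-- The fluxes `f = f((x, t), s)`: smooth, tangent to `Γ(t)`, and tangentially divergence free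
for every fixed value of `s`. -/
structure IsFlux (f : Amb n × ℝ → ℝ → Amb n) : Prop where
  smooth : SmoothOnSet (fun q : (Amb n × ℝ) × ℝ => f q.1 q.2) (M.spaceTime ×ˢ univ)
  tangent : ∀ t ∈ Ioo 0 T, ∀ x ∈ M.Γ t, ∀ s : ℝ, f (x, t) s ∈ tangentSpaceAt (M.Γ t) x
  div_free : ∀ t ∈ Ioo 0 T, ∀ s : ℝ, ∀ x ∈ M.Γ t,
    surfaceDiv (M.Γ t) (fun y => f (y, t) s) x = 0

/-- The diffusion matrices `B = B(x, t)`: smooth, symmetric, mapping the tangent space of `Γ(t)`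
into itself, vanishing on normal vectors, and positive definite on the tangent space. -/
structure IsDiffusionMatrix (B : Amb n × ℝ → Amb n →L[ℝ] Amb n) : Prop where
  smooth : SmoothOnSet B M.spaceTime
  symmetric : ∀ t ∈ Ioo 0 T, ∀ x ∈ M.Γ t, ∀ a b : Amb n,
    inner ℝ (B (x, t) a) b = inner ℝ a (B (x, t) b)
  tangent : ∀ t ∈ Ioo 0 T, ∀ x ∈ M.Γ t, ∀ a ∈ tangentSpaceAt (M.Γ t) x,
    B (x, t) a ∈ tangentSpaceAt (M.Γ t) x
  normal : ∀ t ∈ Ioo 0 T, ∀ x ∈ M.Γ t, ∀ a ∈ (tangentSpaceAt (M.Γ t) x)ᗮ, B (x, t) a = 0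
  posDef : ∀ t ∈ Ioo 0 T, ∀ x ∈ M.Γ t, ∀ a ∈ tangentSpaceAt (M.Γ t) x, a ≠ 0 →
    0 < inner ℝ (B (x, t) a) a

/-- `u` is a smooth solution of the initial value problem
`u̇ + u ∇_Γ · v + ∇_Γ · (f(·, u)) - ε ∇_Γ · (B ∇_Γ u) = 0` on `G_T`, `u(·, 0) = u₀` on `Γ(0)`:
it is smooth on `G_T`, continuous up to the initial time, and satisfies both equations pointwise.
The third term is the total divergence of `x ↦ f((x, t), u(x, t))`. -/
structure IsSmoothSolution (f : Amb n × ℝ → ℝ → Amb n) (B : Amb n × ℝ → Amb n →L[ℝ] Amb n)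
    (ε : ℝ) (u₀ : Amb n → ℝ) (u : Amb n × ℝ → ℝ) : Prop where
  smooth : SmoothOnSet u M.spaceTime
  continuousOn : ContinuousOn u M.spaceTimeWithInitial
  pde : ∀ t ∈ Ioo 0 T, ∀ x ∈ M.Γ t,
    M.materialDeriv u (x, t)
      + u (x, t) * surfaceDiv (M.Γ t) (fun y => M.velocity (y, t)) x
      + surfaceDiv (M.Γ t) (fun y => f (y, t) (u (y, t))) x
      - ε * surfaceDiv (M.Γ t)
          (fun y => B (y, t) (tangentialGradient (M.Γ t) (fun z => u (z, t)) y)) x = 0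
  initial : ∀ x ∈ M.Γ 0, u (x, 0) = u₀ x

end MovingHypersurface

end

/-! The proof is a maximum principle. At a spatial maximum of the solution the tangential gradient
vanishes, so the total divergence of the flux reduces to its divergence at a frozen value, which is
zero (`surfaceDiv_comp_of_tangentialGradient_eq_zero`). The diffusion term becomes the trace of the
derivative of the tangential gradient composed with `B`. It is nonpositive, because that derivative
is negative semidefinite on tangent vectors and `B` is positive there
(`IsDefiningFunction.exists_hasFDerivWithinAt_tangentialGradient`, `trace_comp_nonpos`). Only the
sign of the diffusion enters, which is why the bound does not see `ε`. What remains is the expansion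
of the surface: the material derivative is at most `-u` times the divergence of the velocity.

That divergence is bounded by some `K`, by compactness of `Γ(0) × [0, T]`
(`exists_abs_surfaceDiv_velocity_le`). Pulled back by the flow to the fixed compact set `Γ(0)`, the
material derivative is an ordinary time derivative, and `le_mul_exp_of_deriv_le_at_max` gives the
growth bound `c₀ * exp ((K + 1) * t)` for `u`. The same argument at minima bounds `-u`.

The initial bound is only essential. Continuity turns it into a pointwise one, since relatively open
pieces of a hypersurface have positive measure
(`IsClosedSmoothHypersurface.hausdorffMeasure_inter_pos`). -/

/-! ### Tangent spaces and local straightening of a hypersurface -/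

/-- `φ` is a smooth local defining function of the hypersurface `S` on the open set `U`. -/
structure IsDefiningFunction {n : ℕ} (S U : Set (Amb n)) (φ : Amb n → ℝ) : Prop where
  isOpen : IsOpen U
  contDiffOn : ContDiffOn ℝ ∞ φ U
  fderiv_ne_zero : ∀ y ∈ U, fderiv ℝ φ y ≠ 0
  inter_eq : S ∩ U = {y ∈ U | φ y = 0}

theorem IsClosedSmoothHypersurface.exists_isDefiningFunction {n : ℕ} {S : Set (Amb n)}
    (hS : IsClosedSmoothHypersurface S) {x : Amb n} (hx : x ∈ S) :
    ∃ U φ, x ∈ U ∧ IsDefiningFunction S U φ := by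
  obtain ⟨U, hU, hxU, φ, h1, h2, h3⟩ := hS.exists_defining x hx
  exact ⟨U, φ, hxU, hU, h1, h2, h3⟩

/-- The derivative of a map of the line into `S` is a tangent vector. -/
theorem HasDerivAt.mem_tangentConeAt {E : Type*} [NormedAddCommGroup E] [NormedSpace ℝ E]
    {S : Set E} {γ : ℝ → E} {a : E} {s : ℝ} (hγ : HasDerivAt γ a s)
    (hS : ∀ᶠ r in 𝓝 s, γ r ∈ S) : a ∈ tangentConeAt ℝ S (γ s) := by
  have h := hγ.hasFDerivAt.hasFDerivWithinAt (s := {r | γ r ∈ S})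
  have h1 : (1 : ℝ) ∈ tangentConeAt ℝ {r | γ r ∈ S} s := by
    rw [tangentConeAt_of_mem_nhds hS]; trivial
  have h2 := h.mapsTo_tangent_cone h1
  simp only [ContinuousLinearMap.toSpanSingleton_apply, one_smul] at h2
  exact tangentConeAt_mono (by rintro _ ⟨r, hr, rfl⟩; exact hr) h2

/-- Two derivatives of a function along `S` agree on the tangent space. -/
theorem HasFDerivWithinAt.eq_of_mem_tangentSpaceAt {n : ℕ} {W : Type*} [NormedAddCommGroup W]
    [NormedSpace ℝ W] {S : Set (Amb n)} {g : Amb n → W} {A A' : Amb n →L[ℝ] W} {x a : Amb n}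
    (h : HasFDerivWithinAt g A S x) (h' : HasFDerivWithinAt g A' S x)
    (ha : a ∈ tangentSpaceAt S x) : A a = A' a := by
  induction ha using Submodule.span_induction with
  | mem a ha => exact h.unique_on h' ha
  | zero => simp
  | add a b _ _ ha hb => rw [map_add, map_add, ha, hb]
  | smul r a _ ha => rw [map_smul, map_smul, ha]

/-- A derivative of a map from `S` to `S'` maps tangent vectors to tangent vectors. -/
theorem HasFDerivWithinAt.map_mem_tangentSpaceAt {n : ℕ} {S S' : Set (Amb n)}
    {g : Amb n → Amb n} {A : Amb n →L[ℝ] Amb n} {x a : Amb n} (h : HasFDerivWithinAt g A S x)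
    (hg : MapsTo g S S') (ha : a ∈ tangentSpaceAt S x) : A a ∈ tangentSpaceAt S' (g x) := by
  induction ha using Submodule.span_induction with
  | mem a ha =>
    exact Submodule.subset_span (tangentConeAt_mono hg.image_subset (h.mapsTo_tangent_cone ha))
  | zero => simp
  | add a b _ _ ha hb => rw [map_add]; exact add_mem ha hb
  | smul r a _ ha => rw [map_smul]; exact Submodule.smul_mem _ _ ha

namespace IsDefiningFunction

variable {n : ℕ} {S U : Set (Amb n)} {φ : Amb n → ℝ} {x : Amb n}

theorem gradient_ne_zero (h : IsDefiningFunction S U φ) (hx : x ∈ U) : gradient φ x ≠ 0 := by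
  simpa [gradient] using h.fderiv_ne_zero x hx

theorem contDiffAt (h : IsDefiningFunction S U φ) (hx : x ∈ U) : ContDiffAt ℝ ∞ φ x :=
  h.contDiffOn.contDiffAt (h.isOpen.mem_nhds hx)

theorem eq_zero (h : IsDefiningFunction S U φ) (hx : x ∈ U) (hxS : x ∈ S) : φ x = 0 :=
  (h.inter_eq.subset ⟨hxS, hx⟩).2

/-- Local straightening of a hypersurface: a local diffeomorphism which maps the affine tangent
plane to the hypersurface and moves points in normal direction only. -/
theorem exists_straightening (h : IsDefiningFunction S U φ) (hx : x ∈ U) (hxS : x ∈ S) :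
    ∃ ψ : Amb n → Amb n, ContDiffAt ℝ ∞ ψ x ∧ ψ x = x ∧
      HasFDerivAt ψ (ContinuousLinearMap.id ℝ (Amb n)) x ∧
      (∀ᶠ z in 𝓝 x, inner ℝ (gradient φ x) (z - x) = 0 → ψ z ∈ S) ∧
      ∀ᶠ z in 𝓝 x, ∃ r : ℝ, z = ψ z + r • gradient φ x := by
  set N := gradient φ x with hN
  have hN0 : N ≠ 0 := h.gradient_ne_zero hx
  have hN2 : inner ℝ N N ≠ 0 := by simpa using hN0
  -- `κ` is chosen so that `⟨N, Ψ y - x⟩ = φ y`: thus `Ψ` takes the zero set of `φ` into the affine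
  -- tangent plane, moving points along `N` only. Since `κ` has zero derivative at `x`, `Ψ` is
  -- invertible near `x`, and `ψ` is its local inverse.
  set κ : Amb n → ℝ := fun y => (φ y - inner ℝ N (y - x)) / inner ℝ N N with hκ
  set Ψ : Amb n → Amb n := fun y => y + κ y • N with hΨ
  have hφ := h.contDiffAt hx
  have hφ0 := h.eq_zero hx hxS
  have hΨc : ContDiffAt ℝ ∞ Ψ x := by
    have : ContDiffAt ℝ ∞ κ x :=
      (hφ.sub (contDiffAt_const.inner ℝ (contDiffAt_id.sub contDiffAt_const))).div_const _
    exact contDiffAt_id.add (this.smul contDiffAt_const)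
  have hκd : HasFDerivAt κ (0 : Amb n →L[ℝ] ℝ) x := by
    have h1 : HasFDerivAt φ (fderiv ℝ φ x) x := (hφ.differentiableAt (by simp)).hasFDerivAt
    have h2 : HasFDerivAt (fun y => inner ℝ N (y - x)) (innerSL ℝ N) x := by
      have := (innerSL ℝ N).hasFDerivAt (x := x)
      simpa [inner_sub_right] using this.sub_const (inner ℝ N x)
    have h3 := (h1.sub h2).const_mul (inner ℝ N N)⁻¹
    have h4 : fderiv ℝ φ x - innerSL ℝ N = 0 := by
      ext a
      simp only [sub_apply, innerSL_apply_apply, hN, inner_gradient_left]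
      simp
    rw [h4] at h3
    simpa [hκ, div_eq_inv_mul] using h3
  have hΨd : HasFDerivAt Ψ
      ((ContinuousLinearEquiv.refl ℝ (Amb n) : Amb n ≃L[ℝ] Amb n) : Amb n →L[ℝ] Amb n) x := by
    have := (hasFDerivAt_id x).add (hκd.smul_const N)
    convert! this using 1
    ext; simp
  have hs := hΨc.hasStrictFDerivAt' hΨd (by simp)
  have hΨx : Ψ x = x := by simp [hΨ, hκ, hφ0]
  set ψ := hΨc.localInverse hΨd (by simp) with hψ
  have hψx : ψ x = x := by
    have := hΨc.localInverse_apply_image hΨd (by simp)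
    rwa [hΨx] at this
  have hψc : ContDiffAt ℝ ∞ ψ x := by
    have := hΨc.to_localInverse hΨd (by simp)
    rwa [hΨx] at this
  have hψd : HasFDerivAt ψ (ContinuousLinearMap.id ℝ (Amb n)) x := by
    have := hs.to_localInverse.hasFDerivAt
    rw [hΨx] at this
    convert! this using 1
  have hr : ∀ᶠ z in 𝓝 x, Ψ (ψ z) = z := by
    have := hs.eventually_right_inverse
    rwa [hΨx] at this
  have hU : ∀ᶠ z in 𝓝 x, ψ z ∈ U := by
    apply hψc.continuousAt
    rw [hψx]
    exact h.isOpen.mem_nhds hx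
  refine ⟨ψ, hψc, hψx, hψd, ?_, ?_⟩
  · filter_upwards [hr, hU] with z hz hzU h0
    have h1 : inner ℝ N (Ψ (ψ z) - x) = φ (ψ z) := by
      simp only [hΨ, hκ, inner_sub_right, inner_add_right, inner_smul_right]
      rw [div_mul_cancel₀ _ hN2]
      ring
    rw [hz, h0] at h1
    exact (h.inter_eq.superset ⟨hzU, h1.symm⟩).1
  · filter_upwards [hr] with z hz
    exact ⟨κ (ψ z), hz.symm⟩

theorem fderiv_apply_eq_zero (h : IsDefiningFunction S U φ) (hx : x ∈ U) (hxS : x ∈ S)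
    {a : Amb n} (ha : a ∈ tangentSpaceAt S x) : fderiv ℝ φ x a = 0 := by
  have h1 : HasFDerivWithinAt φ (fderiv ℝ φ x) S x :=
    ((h.contDiffAt hx).differentiableAt (by simp)).hasFDerivAt.hasFDerivWithinAt
  have h2 : HasFDerivWithinAt φ (0 : Amb n →L[ℝ] ℝ) S x := by
    refine (hasFDerivWithinAt_const (0 : ℝ) x S).congr_of_eventuallyEq ?_ (h.eq_zero hx hxS)
    filter_upwards [self_mem_nhdsWithin, mem_nhdsWithin_of_mem_nhds (h.isOpen.mem_nhds hx)]
      with y hyS hyU using h.eq_zero hyU hyS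
  exact h1.eq_of_mem_tangentSpaceAt h2 ha

/-- Tangent vectors are velocities of smooth curves in the hypersurface. -/
theorem exists_curve (h : IsDefiningFunction S U φ) (hx : x ∈ U) (hxS : x ∈ S)
    {a : Amb n} (ha : fderiv ℝ φ x a = 0) :
    ∃ γ : ℝ → Amb n, ContDiffAt ℝ ∞ γ 0 ∧ γ 0 = x ∧ HasDerivAt γ a 0 ∧ ∀ᶠ s in 𝓝 0, γ s ∈ S := by
  obtain ⟨ψ, hc, hψx, hd, hS, -⟩ := h.exists_straightening hx hxS
  have hl : HasDerivAt (fun s : ℝ => x + s • a) a 0 := by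
    simpa using ((hasDerivAt_id (0 : ℝ)).smul_const a).const_add x
  have hl0 : x + (0 : ℝ) • a = x := by simp
  refine ⟨fun s => ψ (x + s • a), ?_, by simpa using hψx, ?_, ?_⟩
  · refine ContDiffAt.comp (0 : ℝ) (by rwa [hl0]) ?_
    exact contDiffAt_const.add (contDiffAt_id.smul contDiffAt_const)
  · exact HasFDerivAt.comp_hasDerivAt_of_eq (0 : ℝ) hd hl hl0.symm
  · have ht : Filter.Tendsto (fun s : ℝ => x + s • a) (𝓝 0) (𝓝 x) := by
      simpa using hl.continuousAt.tendsto
    filter_upwards [ht.eventually hS] with s hs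
    apply hs
    simp [inner_smul_right, inner_gradient_left, ha]

/-- The span of the tangent cone is no larger than the kernel because `φ` vanishes on `S`, and no
smaller because the straightening realizes each kernel vector as the velocity of a curve in `S`. -/
theorem mem_tangentSpaceAt_iff (h : IsDefiningFunction S U φ) (hx : x ∈ U) (hxS : x ∈ S)
    {a : Amb n} : a ∈ tangentSpaceAt S x ↔ fderiv ℝ φ x a = 0 := by
  refine ⟨h.fderiv_apply_eq_zero hx hxS, fun ha => ?_⟩
  obtain ⟨γ, -, h0, hd, hS⟩ := h.exists_curve hx hxS ha
  have := hd.mem_tangentConeAt hS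
  rw [h0] at this
  exact Submodule.subset_span this

theorem starProjection_tangentSpaceAt (h : IsDefiningFunction S U φ) (hx : x ∈ U) (hxS : x ∈ S)
    (w : Amb n) : (tangentSpaceAt S x).starProjection w =
      w - (inner ℝ (gradient φ x) w / inner ℝ (gradient φ x) (gradient φ x)) • gradient φ x := by
  have hN2 : inner ℝ (gradient φ x) (gradient φ x) ≠ 0 := by simpa using h.gradient_ne_zero hx
  apply Submodule.eq_starProjection_of_mem_of_inner_eq_zero
  · rw [h.mem_tangentSpaceAt_iff hx hxS, ← inner_gradient_left, inner_sub_right,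
      inner_smul_right, div_mul_cancel₀ _ hN2, sub_self]
  · intro a ha
    rw [sub_sub_cancel, inner_smul_left, inner_gradient_left (y := a),
      h.fderiv_apply_eq_zero hx hxS ha, mul_zero]

end IsDefiningFunction

/-! ### Positivity of the surface measure -/

/-- Non-empty relatively open subsets of a hypersurface have positive surface measure. -/
theorem IsClosedSmoothHypersurface.hausdorffMeasure_inter_pos {n : ℕ} {S V : Set (Amb n)}
    (hS : IsClosedSmoothHypersurface S) {x : Amb n} (hx : x ∈ S) (hV : V ∈ 𝓝 x) :
    0 < (μH[(n : ℝ)] : Measure (Amb n)) (V ∩ S) := by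
  obtain ⟨U, φ, hxU, h⟩ := hS.exists_isDefiningFunction hx
  obtain ⟨ψ, hc, hψx, -, hψS, hψN⟩ := h.exists_straightening hxU hx
  set N := gradient φ x
  have hN0 : N ≠ 0 := h.gradient_ne_zero hxU
  set W : Submodule ℝ (Amb n) := (ℝ ∙ N)ᗮ
  have hfin : Module.finrank ℝ W = n := by
    have : Fact (Module.finrank ℝ (Amb n) = n + 1) := ⟨by simp⟩
    exact Submodule.finrank_orthogonal_span_singleton hN0
  set P : Amb n →L[ℝ] W := W.orthogonalProjectionOnto
  have hPN : P N = 0 := by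
    rw [Submodule.orthogonalProjectionOnto_eq_zero_iff]
    exact Submodule.le_orthogonal_orthogonal _ (Submodule.mem_span_singleton_self N)
  have hLip : LipschitzWith 1 P := Submodule.lipschitzWith_orthogonalProjectionOnto W
  -- A point of the tangent plane and its image under `ψ` differ by a multiple of `N`, which `P`
  -- kills. Hence the projection of `V ∩ S` covers a neighbourhood in the `n`-dimensional space `W`;
  -- as `P` is 1-Lipschitz, it cannot increase Hausdorff measure.
  have himg : P '' (V ∩ S) ∈ 𝓝 (P x) := by
    have ht : Filter.Tendsto (fun w : W => (w : Amb n) + (x - P x)) (𝓝 (P x)) (𝓝 x) := by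
      have : Continuous (fun w : W => (w : Amb n) + (x - P x)) := by fun_prop
      simpa using this.tendsto (P x)
    have hVψ : ∀ᶠ z in 𝓝 x, ψ z ∈ V := by
      apply hc.continuousAt
      rwa [hψx]
    filter_upwards [ht.eventually hψS, ht.eventually hψN, ht.eventually hVψ] with w h1 h2 h3
    have hw : inner ℝ N ((w : Amb n) + (x - P x) - x) = 0 := by
      have : (w : Amb n) + (x - P x) - x = ((w - P x : W) : Amb n) := by
        push_cast; abel
      rw [this]
      exact (Submodule.mem_orthogonal_singleton_iff_inner_right).1 (w - P x).2
    refine ⟨_, ⟨h3, h1 hw⟩, ?_⟩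
    obtain ⟨r, hr⟩ := h2
    have := congrArg P hr
    rw [map_add, map_add, map_sub, map_smul, hPN, smul_zero, add_zero] at this
    rw [← this]
    have hP : P (P x : Amb n) = P x := W.orthogonalProjectionOnto_mem_subspace_eq_self (P x)
    rw [hP, sub_self, add_zero]
    exact W.orthogonalProjectionOnto_mem_subspace_eq_self w
  have hpos : 0 < (μH[(n : ℝ)] : Measure W) (P '' (V ∩ S)) := by
    have := Measure.measure_pos_of_mem_nhds (μH[(Module.finrank ℝ W : ℝ)] : Measure W) himg
    rwa [hfin] at this
  refine hpos.trans_le ?_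
  simpa using hLip.hausdorffMeasure_image_le (Nat.cast_nonneg n) (V ∩ S)

/-! ### Tangential calculus at critical points -/

theorem ContDiffAt.fderiv_contDiffAt_one {V W : Type*} [NormedAddCommGroup V] [NormedSpace ℝ V]
    [NormedAddCommGroup W] [NormedSpace ℝ W] {f : V → W} {x : V} (hf : ContDiffAt ℝ ∞ f x) :
    ContDiffAt ℝ 1 (fderiv ℝ f) x :=
  hf.fderiv_right (by rw [one_add_one_eq_two]; exact ENat.LEInfty.out)

namespace SmoothOnSet

variable {V W Z : Type*} [NormedAddCommGroup V] [NormedSpace ℝ V] [NormedAddCommGroup W]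
  [NormedSpace ℝ W] [NormedAddCommGroup Z] [NormedSpace ℝ Z] {g : V → W} {S : Set V}

theorem comp_contDiff (hg : SmoothOnSet g S) {ι : Z → V} (hι : ContDiff ℝ ∞ ι) {S' : Set Z}
    (hS : MapsTo ι S' S) : SmoothOnSet (fun z => g (ι z)) S' := by
  intro z hz
  obtain ⟨U, hU, hzU, G, hG, hGg⟩ := hg (ι z) (hS hz)
  exact ⟨ι ⁻¹' U, hU.preimage hι.continuous, hzU, fun w => G (ι w),
    hG.comp hι.contDiffOn (fun _ hw => hw), fun w hw => hGg ⟨hw.1, hS hw.2⟩⟩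

theorem neg (hg : SmoothOnSet g S) : SmoothOnSet (fun z => -g z) S := by
  intro z hz
  obtain ⟨U, hU, hzU, G, hG, hGg⟩ := hg z hz
  exact ⟨U, hU, hzU, fun w => -G w, hG.neg, fun w hw => congrArg Neg.neg (hGg hw)⟩

theorem exists_contDiffAt (hg : SmoothOnSet g S) {x : V} (hx : x ∈ S) :
    ∃ G : V → W, ContDiffAt ℝ ∞ G x ∧ G x = g x ∧ g =ᶠ[𝓝[S] x] G := by
  obtain ⟨U, hU, hxU, G, hG, hGg⟩ := hg x hx
  refine ⟨G, hG.contDiffAt (hU.mem_nhds hxU), hGg ⟨hxU, hx⟩, ?_⟩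
  filter_upwards [self_mem_nhdsWithin, mem_nhdsWithin_of_mem_nhds (hU.mem_nhds hxU)]
    with y hyS hyU using (hGg ⟨hyU, hyS⟩).symm

theorem exists_hasFDerivWithinAt (hg : SmoothOnSet g S) {x : V} (hx : x ∈ S) :
    ∃ L : V →L[ℝ] W, HasFDerivWithinAt g L S x := by
  obtain ⟨G, hG, hGx, hgG⟩ := hg.exists_contDiffAt hx
  exact ⟨fderiv ℝ G x, (hG.differentiableAt (by simp)).hasFDerivAt.hasFDerivWithinAt
    |>.congr_of_eventuallyEq hgG hGx.symm⟩

end SmoothOnSet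

section Derivatives

variable {n : ℕ} {S : Set (Amb n)} {x : Amb n}

/-- `gradientWithin` rests on one chosen derivative along `S`, but all of them agree on the tangent
space, and the projection sees nothing else. Any convenient derivative `A` may therefore be used. -/
theorem inner_tangentialGradient {g : Amb n → ℝ} {A : Amb n →L[ℝ] ℝ}
    (hg : HasFDerivWithinAt g A S x) (a : Amb n) :
    inner ℝ (tangentialGradient S g x) a = A ((tangentSpaceAt S x).starProjection a) := by
  rw [tangentialGradient, Submodule.inner_starProjection_left_eq_right, inner_gradientWithin_left]
  exact hg.differentiableWithinAt.hasFDerivWithinAt.eq_of_mem_tangentSpaceAt hg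
    (Submodule.starProjection_apply_mem _ _)

theorem tangentialGradient_neg {g : Amb n → ℝ} {A : Amb n →L[ℝ] ℝ}
    (hg : HasFDerivWithinAt g A S x) :
    tangentialGradient S (fun y => -g y) x = -tangentialGradient S g x := by
  refine ext_inner_right ℝ fun a => ?_
  rw [inner_neg_left, inner_tangentialGradient hg, inner_tangentialGradient hg.fun_neg]
  rfl

/-- The surface divergence is the trace of the tangential derivative. -/
theorem surfaceDiv_eq_trace {X : Amb n → Amb n} {A : Amb n →L[ℝ] Amb n}
    (hX : HasFDerivWithinAt X A S x) :
    surfaceDiv S X x = LinearMap.trace ℝ (Amb n)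
      (A ∘L (tangentSpaceAt S x).starProjection : Amb n →L[ℝ] Amb n) := by
  rw [LinearMap.trace_eq_sum_inner _ (EuclideanSpace.basisFun (Fin (n + 1)) ℝ), surfaceDiv]
  refine Finset.sum_congr rfl fun j _ => ?_
  have hj : HasFDerivWithinAt (fun y => X y j) ((EuclideanSpace.proj j).comp A) S x :=
    (EuclideanSpace.proj (𝕜 := ℝ) j).hasFDerivAt.comp_hasFDerivWithinAt x hX
  have h := inner_tangentialGradient hj (EuclideanSpace.basisFun (Fin (n + 1)) ℝ j)
  simp only [EuclideanSpace.basisFun_apply] at h ⊢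
  rw [EuclideanSpace.inner_single_right] at h
  rw [EuclideanSpace.inner_single_left]
  simpa using h

theorem tangentialGradient_mem (g : Amb n → ℝ) :
    tangentialGradient S g x ∈ tangentSpaceAt S x :=
  Submodule.starProjection_apply_mem _ _

/-- A nonlinear flux contributes nothing to its total divergence at a critical point of the
unknown, apart from the divergence at a frozen value. -/
theorem surfaceDiv_comp_of_tangentialGradient_eq_zero {F : Amb n → ℝ → Amb n} {g : Amb n → ℝ}
    (hF : SmoothOnSet (fun q : Amb n × ℝ => F q.1 q.2) (S ×ˢ univ)) (hg : SmoothOnSet g S)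
    (hx : x ∈ S) (h0 : tangentialGradient S g x = 0) :
    surfaceDiv S (fun y => F y (g y)) x = surfaceDiv S (fun y => F y (g x)) x := by
  obtain ⟨L, hL⟩ := hF.exists_hasFDerivWithinAt (x := (x, g x)) ⟨hx, trivial⟩
  obtain ⟨A, hA⟩ := hg.exists_hasFDerivWithinAt hx
  have h1 : HasFDerivWithinAt (fun y => F y (g y))
      (L ∘L (ContinuousLinearMap.id ℝ (Amb n)).prod A) S x :=
    hL.comp (f := fun y => (y, g y)) x ((hasFDerivWithinAt_id x S).prodMk hA)
      (fun y hy => ⟨hy, trivial⟩)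
  have h2 : HasFDerivWithinAt (fun y => F y (g x))
      (L ∘L (ContinuousLinearMap.id ℝ (Amb n)).prod (0 : Amb n →L[ℝ] ℝ)) S x :=
    hL.comp (f := fun y => (y, g x)) x
      ((hasFDerivWithinAt_id x S).prodMk (hasFDerivWithinAt_const (g x) x S))
      (fun y hy => ⟨hy, trivial⟩)
  rw [surfaceDiv_eq_trace h1, surfaceDiv_eq_trace h2]
  congr 2
  ext1 a
  have : A ((tangentSpaceAt S x).starProjection a) = 0 := by
    rw [← inner_tangentialGradient hA, h0, inner_zero_left]
  simp [this]

/-- First and second order conditions for a maximum of a function on a hypersurface. -/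
theorem IsDefiningFunction.exists_hasFDerivWithinAt_tangentialGradient {U : Set (Amb n)}
    {φ g : Amb n → ℝ} (h : IsDefiningFunction S U φ) (hx : x ∈ U) (hxS : x ∈ S)
    (hg : SmoothOnSet g S) (hmax : IsMaxOn g S x) :
    tangentialGradient S g x = 0 ∧ ∃ A : Amb n →L[ℝ] Amb n,
      HasFDerivWithinAt (tangentialGradient S g) A S x ∧
      ∀ a ∈ tangentSpaceAt S x, inner ℝ (A a) a ≤ 0 := by
  obtain ⟨V, hV, hxV, G, hG, hGg⟩ := hg x hxS
  have hGx : ContDiffAt ℝ ∞ G x := hG.contDiffAt (hV.mem_nhds hxV)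
  have hgrad : ∀ {f : Amb n → ℝ}, ContDiffAt ℝ ∞ f x → DifferentiableAt ℝ (gradient f) x := by
    intro f hf
    exact ((InnerProductSpace.toDual ℝ (Amb n)).symm.toContinuousLinearEquiv.differentiableAt).comp
      x (hf.fderiv_contDiffAt_one.differentiableAt (by simp))
  -- `Q` extends the tangential gradient to a neighbourhood in the ambient space, so that it can be
  -- differentiated there.
  set Q : Amb n → Amb n := fun y => gradient G y -
    (inner ℝ (gradient φ y) (gradient G y) / inner ℝ (gradient φ y) (gradient φ y)) •
      gradient φ y with hQ
  have hQd : DifferentiableAt ℝ Q x := by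
    have h1 := hgrad hGx
    have h2 := hgrad (h.contDiffAt hx)
    have h3 : inner ℝ (gradient φ x) (gradient φ x) ≠ 0 := by simpa using h.gradient_ne_zero hx
    simp only [hQ, div_eq_mul_inv]
    exact h1.sub (((h2.inner ℝ h1).mul ((h2.inner ℝ h2).inv h3)).smul h2)
  have hQS : ∀ y ∈ U ∩ V, y ∈ S → tangentialGradient S g y = Q y := by
    intro y hy hyS
    rw [tangentialGradient_eq_of_extension hyS hV hy.2
      ((hG.contDiffAt (hV.mem_nhds hy.2)).differentiableAt (by simp)) hGg,
      h.starProjection_tangentSpaceAt hy.1 hyS]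
  have hUV : U ∩ V ∈ 𝓝 x := (h.isOpen.inter hV).mem_nhds ⟨hx, hxV⟩
  have hev : tangentialGradient S g =ᶠ[𝓝[S] x] Q := by
    filter_upwards [self_mem_nhdsWithin, mem_nhdsWithin_of_mem_nhds hUV] with y hyS hy
      using hQS y hy hyS
  have hcurve : ∀ a ∈ tangentSpaceAt S x, ∃ γ : ℝ → Amb n, ContDiffAt ℝ ∞ γ 0 ∧ γ 0 = x ∧
      HasDerivAt γ a 0 ∧ (∀ᶠ s in 𝓝 0, γ s ∈ S) ∧ IsLocalMax (fun s => G (γ s)) 0 ∧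
      ∀ᶠ s in 𝓝 0, HasDerivAt (fun s => G (γ s)) (inner ℝ (Q (γ s)) (deriv γ s)) s := by
    intro a ha
    obtain ⟨γ, hγ, hγ0, hγa, hγS⟩ := h.exists_curve hx hxS (h.fderiv_apply_eq_zero hx hxS ha)
    have hγUV : ∀ᶠ s in 𝓝 0, γ s ∈ U ∩ V := by
      apply hγ.continuousAt
      rwa [hγ0]
    refine ⟨γ, hγ, hγ0, hγa, hγS, ?_, ?_⟩
    · filter_upwards [hγS, hγUV] with s h1 h2
      simp only [hγ0]
      rw [hGg ⟨h2.2, h1⟩, hGg ⟨hxV, hxS⟩]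
      exact hmax h1
    · have hγ1 : ∀ᶠ s in 𝓝 0, ContDiffAt ℝ 1 γ s :=
        (hγ.of_le (m := 1) ENat.LEInfty.out).eventually (by simp)
      filter_upwards [hγS.eventually_nhds, hγUV, hγ1] with s h1 h2 h3
      have h4 : HasDerivAt γ (deriv γ s) s := (h3.differentiableAt (by simp)).hasDerivAt
      have h5 : fderiv ℝ φ (γ s) (deriv γ s) = 0 :=
        h.fderiv_apply_eq_zero h2.1 h1.self_of_nhds
          (Submodule.subset_span (h4.mem_tangentConeAt h1))
      have h6 : HasFDerivAt G (fderiv ℝ G (γ s)) (γ s) :=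
        ((hG.contDiffAt (hV.mem_nhds h2.2)).differentiableAt (by simp)).hasFDerivAt
      have h7 : inner ℝ (Q (γ s)) (deriv γ s) = fderiv ℝ G (γ s) (deriv γ s) := by
        rw [hQ]
        simp only [inner_sub_left, inner_smul_left, inner_gradient_left, h5, mul_zero, sub_zero]
      rw [h7]
      exact h6.comp_hasDerivAt s h4
  -- `Q x` is itself tangent: along a curve with this velocity, the derivative at the maximum is `‖Q
  -- x‖²`.
  have hQx : Q x = 0 := by
    have hmem : Q x ∈ tangentSpaceAt S x := by
      rw [← hQS x ⟨hx, hxV⟩ hxS]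
      exact tangentialGradient_mem g
    obtain ⟨γ, -, hγ0, hγa, -, hm, hd⟩ := hcurve _ hmem
    have := hm.hasDerivAt_eq_zero hd.self_of_nhds
    rw [hγa.deriv, hγ0] at this
    exact inner_self_eq_zero.1 this
  have hgx : tangentialGradient S g x = Q x := hQS x ⟨hx, hxV⟩ hxS
  refine ⟨hgx.trans hQx, fderiv ℝ Q x,
    hQd.hasFDerivAt.hasFDerivWithinAt.congr_of_eventuallyEq hev hgx, fun a ha => ?_⟩
  obtain ⟨γ, hγ, hγ0, hγa, -, hm, hd⟩ := hcurve a ha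
  have h1 : deriv (fun s => G (γ s)) =ᶠ[𝓝 0] fun s => inner ℝ (Q (γ s)) (deriv γ s) :=
    hd.mono fun s hs => hs.deriv
  have h2 : HasDerivAt (fun s => Q (γ s)) (fderiv ℝ Q x a) 0 :=
    HasFDerivAt.comp_hasDerivAt_of_eq (0 : ℝ) hQd.hasFDerivAt hγa hγ0.symm
  have h3 : HasDerivAt (deriv γ) (deriv (deriv γ) 0) 0 := by
    have : ContDiffAt ℝ 1 (fun s => deriv γ s) 0 := by
      simp only [← fderiv_apply_one_eq_deriv]
      exact hγ.fderiv_contDiffAt_one.clm_apply contDiffAt_const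
    exact (this.differentiableAt (by simp)).hasDerivAt
  -- The acceleration of the curve is paired with `Q x = 0`, so no curvature term survives.
  have h4 : deriv (deriv fun s => G (γ s)) 0 = inner ℝ (fderiv ℝ Q x a) a := by
    rw [h1.deriv_eq, (h2.inner ℝ h3).deriv, hγ0, hQx, inner_zero_left, zero_add, hγa.deriv]
  -- A positive second derivative would make the local maximum a local minimum too; the function
  -- would be locally constant, with zero second derivative.
  by_contra! hpos
  rw [← h4] at hpos
  have hmin := isLocalMin_of_deriv_deriv_pos hpos (hm.deriv_eq_zero)
    hd.self_of_nhds.continuousAt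
  have hconst : (fun s => G (γ s)) =ᶠ[𝓝 0] fun _ => G (γ 0) := by
    filter_upwards [hm, hmin] with s h5 h6 using le_antisymm h5 h6
  have : deriv (deriv fun s => G (γ s)) 0 = 0 := by
    rw [hconst.deriv.deriv_eq]
    simp
  exact hpos.ne' this

/-- The trace of `A ∘ B` for `B` symmetric and positive definite on an invariant subspace, zero on
its complement, and `A` negative semidefinite on this subspace. -/
theorem trace_comp_nonpos {E : Type*} [NormedAddCommGroup E] [InnerProductSpace ℝ E]
    [FiniteDimensional ℝ E] {K : Submodule ℝ E} {A B : E →L[ℝ] E}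
    (hsymm : ∀ a b, inner ℝ (B a) b = inner ℝ a (B b)) (hBK : ∀ a, B a ∈ K)
    (hpos : ∀ a ∈ K, a ≠ 0 → 0 < inner ℝ (B a) a) (hA : ∀ a ∈ K, inner ℝ (A a) a ≤ 0) :
    LinearMap.trace ℝ E (A ∘L B : E →L[ℝ] E) ≤ 0 := by
  have hs : (B : E →ₗ[ℝ] E).IsSymmetric := hsymm
  -- In an eigenbasis of `B` each diagonal entry is `l * ⟨A e, e⟩`. Eigenvectors with `l ≠ 0` lie in
  -- `K`, where `l > 0` and `A` is nonpositive; the others contribute zero.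
  rw [LinearMap.trace_eq_sum_inner _ (hs.eigenvectorBasis rfl)]
  refine Finset.sum_nonpos fun i _ => ?_
  set e := hs.eigenvectorBasis rfl i with he
  set l := hs.eigenvalues rfl i with hl
  have hBe : B e = l • e := hs.apply_eigenvectorBasis rfl i
  have he1 : ‖e‖ = 1 := (hs.eigenvectorBasis rfl).orthonormal.1 i
  by_cases hl0 : l = 0
  · simp [hBe, hl0]
  · have heK : e ∈ K := by
      have : e = l⁻¹ • B e := by rw [hBe, smul_smul, inv_mul_cancel₀ hl0, one_smul]
      rw [this]
      exact K.smul_mem _ (hBK e)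
    have hlpos : 0 < l := by
      have := hpos e heK (by intro h; simp [h] at he1)
      rwa [hBe, inner_smul_left, real_inner_self_eq_norm_sq, he1, one_pow, mul_one] at this
    have : inner ℝ e ((A ∘L B) e) = l * inner ℝ (A e) e := by
      rw [ContinuousLinearMap.comp_apply, hBe, map_smul, inner_smul_right, real_inner_comm]
    exact this.trans_le (mul_nonpos_of_nonneg_of_nonpos hlpos.le (hA e heK))

/-- The diffusion term at a critical point. -/
theorem surfaceDiv_diffusion_eq_trace {b : Amb n → Amb n →L[ℝ] Amb n} {X : Amb n → Amb n}
    {A : Amb n →L[ℝ] Amb n} (hb : SmoothOnSet b S) (hx : x ∈ S)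
    (hX : HasFDerivWithinAt X A S x) (h0 : X x = 0) (hbK : ∀ a, b x a ∈ tangentSpaceAt S x) :
    surfaceDiv S (fun y => b y (X y)) x =
      LinearMap.trace ℝ (Amb n) (A ∘L b x : Amb n →L[ℝ] Amb n) := by
  obtain ⟨b', hb'⟩ := hb.exists_hasFDerivWithinAt hx
  have h1 : HasFDerivWithinAt (fun y => b y (X y)) (b x ∘L A) S x := by
    -- The derivative of `b` is applied to `X x = 0` and drops out.
    have := hb'.clm_apply hX
    rw [h0, map_zero, add_zero] at this
    exact this
  have h2 : (tangentSpaceAt S x).starProjection ∘L b x = b x := by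
    ext1 a
    exact Submodule.starProjection_eq_self_iff.2 (hbK a)
  rw [surfaceDiv_eq_trace h1]
  set P := (tangentSpaceAt S x).starProjection
  calc LinearMap.trace ℝ (Amb n) ((b x ∘L A) ∘L P : Amb n →L[ℝ] Amb n)
      = LinearMap.trace ℝ (Amb n) ((b x : Amb n →ₗ[ℝ] Amb n) * ((A ∘L P : Amb n →L[ℝ] Amb n))) :=
        rfl
    _ = LinearMap.trace ℝ (Amb n) (A ∘L (P ∘L b x) : Amb n →L[ℝ] Amb n) := by
        rw [LinearMap.trace_mul_comm]; rfl
    _ = _ := by rw [h2]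

end Derivatives

/-! ### Boundedness of the divergence of the velocity -/

theorem abs_trace_le {n : ℕ} {A : Amb n →L[ℝ] Amb n} {C : ℝ} (hA : ∀ a, ‖A a‖ ≤ C * ‖a‖) :
    |LinearMap.trace ℝ (Amb n) (A : Amb n →ₗ[ℝ] Amb n)| ≤ (n + 1) * C := by
  rw [LinearMap.trace_eq_sum_inner _ (EuclideanSpace.basisFun (Fin (n + 1)) ℝ)]
  refine (Finset.abs_sum_le_sum_abs _ _).trans ?_
  have : ∀ i ∈ Finset.univ, |inner ℝ (EuclideanSpace.basisFun (Fin (n + 1)) ℝ i)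
      ((A : Amb n →ₗ[ℝ] Amb n) (EuclideanSpace.basisFun (Fin (n + 1)) ℝ i))| ≤ C := by
    intro i _
    refine (abs_real_inner_le_norm _ _).trans ?_
    have h1 := (EuclideanSpace.basisFun (Fin (n + 1)) ℝ).orthonormal.1 i
    have h2 := hA (EuclideanSpace.basisFun (Fin (n + 1)) ℝ i)
    rw [h1, mul_one] at h2
    rwa [h1, one_mul]
  simpa using Finset.sum_le_sum this

/-- An injective linear map of a finite-dimensional space is bounded below, uniformly in a
neighbourhood. -/
theorem exists_eventually_norm_le_of_injective {X E F : Type*} [TopologicalSpace X]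
    [NormedAddCommGroup E] [NormedSpace ℝ E] [FiniteDimensional ℝ E] [NormedAddCommGroup F]
    [NormedSpace ℝ F] {L : X → E →L[ℝ] F} {p : X} (hL : ContinuousAt L p)
    (hinj : ∀ b, L p b = 0 → b = 0) :
    ∃ K : ℝ, 0 ≤ K ∧ ∀ᶠ q in 𝓝 p, ∀ b, ‖b‖ ≤ K * ‖L q b‖ := by
  obtain ⟨K, hK, hanti⟩ := (L p : E →ₗ[ℝ] F).exists_antilipschitzWith
    (LinearMap.ker_eq_bot'.2 hinj)
  have hb : ∀ b, ‖b‖ ≤ K * ‖L p b‖ := ZeroHomClass.bound_of_antilipschitz (L p) hanti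
  have hK' : (0 : ℝ) < K := hK
  -- Doubling `K` leaves room to absorb the perturbation `L q - L p`, which costs at most `‖b‖ / 2`.
  refine ⟨2 * K, by positivity, ?_⟩
  filter_upwards [Metric.continuousAt_iff'.1 hL (1 / (2 * K)) (by positivity)] with q hq b
  rw [dist_eq_norm] at hq
  have h1 : ‖L p b‖ ≤ ‖L q b‖ + ‖L q - L p‖ * ‖b‖ := by
    have := norm_sub_le (L q b) ((L q - L p) b)
    have h2 : L q b - (L q - L p) b = L p b := by simp
    rw [h2] at this
    exact this.trans (add_le_add le_rfl ((L q - L p).le_opNorm b))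
  have h3 : K * (‖L q - L p‖ * ‖b‖) ≤ ‖b‖ / 2 := by
    have : (K : ℝ) * ‖L q - L p‖ ≤ 1 / 2 := by
      calc (K : ℝ) * ‖L q - L p‖ ≤ K * (1 / (2 * K)) := by gcongr
        _ = 1 / 2 := by field_simp
    nlinarith [norm_nonneg b]
  have h4 := hb b
  nlinarith

theorem SmoothOnSet.continuousOn {V W : Type*} [NormedAddCommGroup V] [NormedSpace ℝ V]
    [NormedAddCommGroup W] [NormedSpace ℝ W] {g : V → W} {S : Set V} (hg : SmoothOnSet g S) :
    ContinuousOn g S := fun _ hx => (hg.exists_hasFDerivWithinAt hx).choose_spec.continuousWithinAt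

namespace MovingHypersurface

variable {n : ℕ} {T : ℝ} (M : MovingHypersurface n T)

/-- The inverse of the flow map at a fixed time. -/
noncomputable def flowInv (t : ℝ) : Amb n → Amb n :=
  Function.invFunOn (fun y => M.Φ (y, t)) (M.Γ 0)

variable {M} {t : ℝ} {y : Amb n}

theorem flowInv_flow (ht : t ∈ Icc 0 T) (hy : y ∈ M.Γ 0) : M.flowInv t (M.Φ (y, t)) = y :=
  (M.bijOn t ht).injOn.leftInvOn_invFunOn hy

theorem mapsTo_flowInv (ht : t ∈ Icc 0 T) : MapsTo (M.flowInv t) (M.Γ t) (M.Γ 0) :=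
  (M.bijOn t ht).surjOn.mapsTo_invFunOn

theorem flow_flowInv (ht : t ∈ Icc 0 T) {x : Amb n} (hx : x ∈ M.Γ t) :
    M.Φ (M.flowInv t x, t) = x :=
  (M.bijOn t ht).surjOn.rightInvOn_invFunOn hx

theorem velocity_eq (x : Amb n) (t : ℝ) :
    M.velocity (x, t) = derivWithin (fun s => M.Φ (M.flowInv t x, s)) (Icc 0 T) t := rfl

/-- `G` is a smooth extension of the flow map to the open set `W`. -/
structure IsFlowExtension (M : MovingHypersurface n T) (G : Amb n × ℝ → Amb n)
    (W : Set (Amb n × ℝ)) : Prop where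
  isOpen : IsOpen W
  contDiffOn : ContDiffOn ℝ ∞ G W
  eqOn : EqOn G M.Φ (W ∩ M.Γ 0 ×ˢ Icc 0 T)

namespace IsFlowExtension

variable {G : Amb n × ℝ → Amb n} {W : Set (Amb n × ℝ)}

theorem contDiffAt (h : M.IsFlowExtension G W) {q : Amb n × ℝ} (hq : q ∈ W) :
    ContDiffAt ℝ ∞ G q := h.contDiffOn.contDiffAt (h.isOpen.mem_nhds hq)

theorem hasFDerivWithinAt_flow (h : M.IsFlowExtension G W) (ht : t ∈ Icc 0 T) (hy : y ∈ M.Γ 0) (hW' : (y, t) ∈ W) :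
    HasFDerivWithinAt (fun z => M.Φ (z, t))
      (fderiv ℝ G (y, t) ∘L ContinuousLinearMap.inl ℝ (Amb n) ℝ) (M.Γ 0) y := by
  have h1 : HasFDerivAt G (fderiv ℝ G (y, t)) (y, t) :=
    ((h.contDiffAt hW').differentiableAt (by simp)).hasFDerivAt
  have h2 : HasFDerivAt (fun z => G (z, t))
      (fderiv ℝ G (y, t) ∘L ContinuousLinearMap.inl ℝ (Amb n) ℝ) y :=
    h1.comp y (hasFDerivAt_prodMk_left y t)
  refine h2.hasFDerivWithinAt.congr_of_eventuallyEq ?_ (h.eqOn ⟨hW', hy, ht⟩).symm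
  have h3 : ∀ᶠ z in 𝓝 y, (z, t) ∈ W :=
    (Continuous.prodMk_left t).continuousAt.eventually (h.isOpen.mem_nhds hW')
  filter_upwards [self_mem_nhdsWithin, mem_nhdsWithin_of_mem_nhds h3] with z h4 h5
    using (h.eqOn ⟨h5, h4, ht⟩).symm

theorem derivWithin_flow (h : M.IsFlowExtension G W) (hT : 0 < T) (ht : t ∈ Icc 0 T) (hy : y ∈ M.Γ 0) (hW' : (y, t) ∈ W) :
    derivWithin (fun s => M.Φ (y, s)) (Icc 0 T) t = fderiv ℝ G (y, t) (0, 1) := by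
  have h1 : HasFDerivAt G (fderiv ℝ G (y, t)) (y, t) :=
    ((h.contDiffAt hW').differentiableAt (by simp)).hasFDerivAt
  have h2 : HasDerivAt (fun s => G (y, s)) (fderiv ℝ G (y, t) (0, 1)) t :=
    h1.comp_hasDerivAt t ((hasDerivAt_const t y).prodMk (hasDerivAt_id t))
  refine (h2.hasDerivWithinAt.congr_of_eventuallyEq ?_ (h.eqOn ⟨hW', hy, ht⟩).symm).derivWithin
    (uniqueDiffOn_Icc hT t ht)
  have h3 : ∀ᶠ s in 𝓝 t, (y, s) ∈ W :=
    (Continuous.prodMk_right y).continuousAt.eventually (h.isOpen.mem_nhds hW')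
  filter_upwards [self_mem_nhdsWithin, mem_nhdsWithin_of_mem_nhds h3] with z h4 h5
    using (h.eqOn ⟨h5, hy, h4⟩).symm

/-- The inverse flow has a derivative, which is inverse to the derivative of the flow on tangent
vectors. -/
theorem exists_hasFDerivWithinAt_flowInv (h : M.IsFlowExtension G W) (ht : t ∈ Icc 0 T) (hy : y ∈ M.Γ 0)
    (hW' : (y, t) ∈ W) :
    ∃ L : Amb n →L[ℝ] Amb n, HasFDerivWithinAt (M.flowInv t) L (M.Γ t) (M.Φ (y, t)) ∧
      (∀ b ∈ tangentSpaceAt (M.Γ 0) y, L (fderiv ℝ G (y, t) (b, 0)) = b) ∧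
      ∀ a ∈ tangentSpaceAt (M.Γ t) (M.Φ (y, t)), fderiv ℝ G (y, t) (L a, 0) = a := by
  have hx := (M.bijOn t ht).mapsTo hy
  obtain ⟨L, hL⟩ := (M.smooth_inv t ht).exists_hasFDerivWithinAt hx
  change HasFDerivWithinAt (M.flowInv t) L (M.Γ t) (M.Φ (y, t)) at hL
  have hF := h.hasFDerivWithinAt_flow ht hy hW'
  refine ⟨L, hL, fun b hb => ?_, fun a ha => ?_⟩
  · have h1 := hL.comp y hF (M.bijOn t ht).mapsTo
    have h2 : HasFDerivWithinAt (M.flowInv t ∘ fun z => M.Φ (z, t))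
        (ContinuousLinearMap.id ℝ (Amb n)) (M.Γ 0) y :=
      (hasFDerivWithinAt_id y _).congr (fun z hz => flowInv_flow ht hz) (flowInv_flow ht hy)
    simpa using h1.eq_of_mem_tangentSpaceAt h2 hb
  · have h1 := HasFDerivWithinAt.comp (M.Φ (y, t)) ((flowInv_flow ht hy).symm ▸ hF) hL
      (mapsTo_flowInv ht)
    have h2 : HasFDerivWithinAt ((fun z => M.Φ (z, t)) ∘ M.flowInv t)
        (ContinuousLinearMap.id ℝ (Amb n)) (M.Γ t) (M.Φ (y, t)) :=
      (hasFDerivWithinAt_id _ _).congr (fun z hz => flow_flowInv ht hz) (flow_flowInv ht hx)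
    simpa [flowInv_flow ht hy] using h1.eq_of_mem_tangentSpaceAt h2 ha

end IsFlowExtension

/-- In flow coordinates the velocity is the time derivative of `Φ`, so its tangential derivative is
a mixed second derivative of `G` composed with the derivative of the inverse flow. The former is
locally bounded by smoothness; the smoothness of each inverse at a fixed time gives no uniformity in
`t`, so the latter is bounded through the injectivity of the derivative of the flow. -/
theorem exists_eventually_abs_surfaceDiv_velocity_le (hT : 0 < T) {p : Amb n × ℝ}
    (hp : p ∈ M.Γ 0 ×ˢ Icc 0 T) :
    ∃ C : ℝ, ∀ᶠ q in 𝓝[M.Γ 0 ×ˢ Icc 0 T] p,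
      |surfaceDiv (M.Γ q.2) (fun z => M.velocity (z, q.2)) (M.Φ q)| ≤ C := by
  obtain ⟨W, hW, hpW, G, hG, hGΦ⟩ := M.smooth_Φ p hp
  have h : M.IsFlowExtension G W := ⟨hW, hG, hGΦ⟩
  have h0 : (0 : ℝ) ∈ Icc 0 T := ⟨le_rfl, hT.le⟩
  obtain ⟨U, φ, hpU, hφ⟩ := (M.hypersurface 0 h0).exists_isDefiningFunction hp.1
  have hGp : ContDiffAt ℝ ∞ G p := h.contDiffAt hpW
  -- The spatial derivative of `G` is known to be injective only on tangent vectors of `Γ(0)`.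
  -- Adjoining the differential of `φ` makes the map injective on the whole fixed space, where the
  -- lower bound is stable, without changing norms of images of tangent vectors.
  set L : Amb n × ℝ → Amb n →L[ℝ] Amb n × ℝ := fun q =>
    (fderiv ℝ G q ∘L ContinuousLinearMap.inl ℝ (Amb n) ℝ).prod (fderiv ℝ φ q.1) with hL
  have hLc : ContinuousAt L p := by
    have h1 : ContinuousAt (fderiv ℝ G) p := hGp.fderiv_contDiffAt_one.continuousAt
    have h2 : ContinuousAt (fun q : Amb n × ℝ => fderiv ℝ φ q.1) p :=
      ContinuousAt.comp (f := Prod.fst) (x := p)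
        (hφ.contDiffAt hpU).fderiv_contDiffAt_one.continuousAt continuousAt_fst
    have h3 := h1.clm_comp
      (continuousAt_const (y := ContinuousLinearMap.inl ℝ (Amb n) ℝ))
    exact ((ContinuousLinearMap.prodₗᵢ (𝕜 := ℝ) (E := Amb n) (F := Amb n) (G := ℝ)
      ℝ).continuous.continuousAt.comp (h3.prodMk h2))
  have hinj : ∀ b, L p b = 0 → b = 0 := by
    intro b hb
    obtain ⟨L', -, h1, -⟩ := h.exists_hasFDerivWithinAt_flowInv hp.2 hp.1 hpW
    have h2 : fderiv ℝ G p (b, 0) = 0 := congrArg Prod.fst hb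
    have h3 : fderiv ℝ φ p.1 b = 0 := congrArg Prod.snd hb
    rw [← h1 b ((hφ.mem_tangentSpaceAt_iff hpU hp.1).2 h3)]
    change L' (fderiv ℝ G p (b, 0)) = 0
    rw [h2, map_zero]
  obtain ⟨K, hK, hKe⟩ := exists_eventually_norm_le_of_injective hLc hinj
  set R : Amb n × ℝ → Amb n × ℝ →L[ℝ] Amb n × ℝ →L[ℝ] Amb n := fderiv ℝ (fderiv ℝ G) with hR
  have hRc : ContinuousAt R p := by
    exact (hGp.fderiv_right (m := 1 + 1)
      (by norm_num; exact ENat.LEInfty.out)).fderiv_right (m := 1) le_rfl |>.continuousAt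
  have hRe : ∀ᶠ q in 𝓝 p, ‖R q‖ ≤ ‖R p‖ + 1 :=
    (ContinuousAt.norm (f := R) hRc).eventually (eventually_le_nhds (lt_add_one ‖R p‖))
  have hUe : ∀ᶠ q in 𝓝 p, q ∈ W ∧ q.1 ∈ U :=
    (hW.eventually_mem hpW).and (continuousAt_fst.eventually (hφ.isOpen.mem_nhds hpU))
  refine ⟨(n + 1) * ((‖R p‖ + 1) * K), ?_⟩
  filter_upwards [self_mem_nhdsWithin, mem_nhdsWithin_of_mem_nhds hKe,
    mem_nhdsWithin_of_mem_nhds hRe, mem_nhdsWithin_of_mem_nhds hUe]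
  rintro ⟨y, t⟩ ⟨hy, ht⟩ hKq hRq ⟨hqW, hqU⟩
  simp only at hy ht hqU ⊢
  have hx := (M.bijOn t ht).mapsTo hy
  obtain ⟨L', hL', -, hLa⟩ := h.exists_hasFDerivWithinAt_flowInv ht hy hqW
  have hE : HasFDerivAt (fun z => fderiv ℝ G (z, t) (0, 1))
      ((R (y, t)).flip (0, 1) ∘L ContinuousLinearMap.inl ℝ (Amb n) ℝ) y := by
    have h1 : HasFDerivAt (fderiv ℝ G) (R (y, t)) (y, t) :=
      ((h.contDiffAt hqW).fderiv_contDiffAt_one.differentiableAt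
        (by simp)).hasFDerivAt
    have h2 : HasFDerivAt (fun z => fderiv ℝ G (z, t))
        (R (y, t) ∘L ContinuousLinearMap.inl ℝ (Amb n) ℝ) y :=
      HasFDerivAt.comp (g := fderiv ℝ G) y h1 (hasFDerivAt_prodMk_left y t)
    have h3 := h2.clm_apply (hasFDerivAt_const ((0 : Amb n), (1 : ℝ)) y)
    convert! h3 using 1
    ext; simp
  have hv : HasFDerivWithinAt (fun z => M.velocity (z, t))
      (((R (y, t)).flip (0, 1) ∘L ContinuousLinearMap.inl ℝ (Amb n) ℝ) ∘L L')
      (M.Γ t) (M.Φ (y, t)) := by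
    have hE' := hE
    rw [← flowInv_flow ht hy] at hE'
    have h1 := hE'.comp_hasFDerivWithinAt (M.Φ (y, t)) hL'
    rw [flowInv_flow ht hy] at h1
    have h2 : ∀ z ∈ M.Γ t, (M.flowInv t z, t) ∈ W →
        M.velocity (z, t) = fderiv ℝ G (M.flowInv t z, t) (0, 1) := fun z hz hzW =>
      h.derivWithin_flow hT ht (mapsTo_flowInv ht hz) hzW
    refine h1.congr_of_eventuallyEq (f₁ := fun z => M.velocity (z, t)) ?_
      (h2 _ hx (by rwa [flowInv_flow ht hy]))
    have h3 : ∀ᶠ z in 𝓝[M.Γ t] (M.Φ (y, t)), (M.flowInv t z, t) ∈ W := by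
      have : ContinuousWithinAt (fun z => (M.flowInv t z, t)) (M.Γ t) (M.Φ (y, t)) :=
        hL'.continuousWithinAt.prodMk continuousWithinAt_const
      apply this
      simp only [flowInv_flow ht hy]
      exact hW.mem_nhds hqW
    filter_upwards [self_mem_nhdsWithin, h3] with z hz hzW using h2 z hz hzW
  rw [surfaceDiv_eq_trace hv]
  refine abs_trace_le fun a => ?_
  set a' := (tangentSpaceAt (M.Γ t) (M.Φ (y, t))).starProjection a with ha'
  have ha'm : a' ∈ tangentSpaceAt (M.Γ t) (M.Φ (y, t)) := Submodule.starProjection_apply_mem _ _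
  have hbm : L' a' ∈ tangentSpaceAt (M.Γ 0) y := by
    have := hL'.map_mem_tangentSpaceAt (mapsTo_flowInv ht) ha'm
    rwa [flowInv_flow ht hy] at this
  have hb : ‖L' a'‖ ≤ K * ‖a‖ := by
    have h1 := hKq (L' a')
    have h2 : L (y, t) (L' a') = (a', 0) := by
      ext1
      · exact hLa a' ha'm
      · exact hφ.fderiv_apply_eq_zero hqU hy hbm
    rw [h2] at h1
    refine h1.trans (mul_le_mul_of_nonneg_left ?_ hK)
    simpa using Submodule.norm_starProjection_apply_le _ a
  calc ‖R (y, t) (L' a', 0) (0, 1)‖ ≤ ‖R (y, t)‖ * ‖(L' a', (0 : ℝ))‖ * ‖((0 : Amb n), (1 : ℝ))‖ :=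
        (R (y, t)).le_opNorm₂ _ _
    _ = ‖R (y, t)‖ * ‖L' a'‖ := by simp
    _ ≤ (‖R p‖ + 1) * (K * ‖a‖) := by gcongr
    _ = _ := by ring

/-- The divergence of the velocity of the material points is bounded. -/
theorem exists_abs_surfaceDiv_velocity_le (hT : 0 < T) :
    ∃ C : ℝ, 0 ≤ C ∧ ∀ t ∈ Icc 0 T, ∀ x ∈ M.Γ t,
      |surfaceDiv (M.Γ t) (fun z => M.velocity (z, t)) x| ≤ C := by
  have hc : IsCompact (M.Γ 0 ×ˢ Icc 0 T) :=
    (M.hypersurface 0 ⟨le_rfl, hT.le⟩).isCompact.prod isCompact_Icc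
  obtain ⟨C, hC⟩ := hc.induction_on (p := fun s => ∃ C : ℝ, ∀ q ∈ s,
      |surfaceDiv (M.Γ q.2) (fun z => M.velocity (z, q.2)) (M.Φ q)| ≤ C)
    ⟨0, by simp⟩ (fun s s' hss ⟨C, hC⟩ => ⟨C, fun q hq => hC q (hss hq)⟩)
    (fun s s' ⟨C, hC⟩ ⟨C', hC'⟩ => ⟨max C C', fun q hq => hq.elim
      (fun h => (hC q h).trans (le_max_left _ _)) (fun h => (hC' q h).trans (le_max_right _ _))⟩)
    (fun p hp => by
      obtain ⟨C, hC⟩ := exists_eventually_abs_surfaceDiv_velocity_le hT hp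
      exact ⟨_, hC, C, fun q hq => hq⟩)
  refine ⟨max C 0, le_max_right _ _, fun t ht x hx => ?_⟩
  have := hC (M.flowInv t x, t) ⟨mapsTo_flowInv ht hx, ht⟩
  rw [flow_flowInv ht hx] at this
  exact this.trans (le_max_left _ _)

end MovingHypersurface

/-! ### Maximum principle on a fixed compact set -/

/-- Weak parabolic maximum principle: growth of a function which increases at most exponentially
at its positive spatial maxima. -/
theorem le_mul_exp_of_deriv_le_at_max {Y : Type*} [TopologicalSpace Y] {C : Set Y}
    (hC : IsCompact C) {T K c₀ : ℝ} (hc₀ : 0 ≤ c₀) {W : Y × ℝ → ℝ}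
    (hW : ContinuousOn W (C ×ˢ Ico 0 T)) (h0 : ∀ y ∈ C, W (y, 0) ≤ c₀)
    (hd : ∀ t ∈ Ioo 0 T, ∀ y ∈ C, IsMaxOn (fun z => W (z, t)) C y → 0 < W (y, t) →
      ∃ d, HasDerivAt (fun s => W (y, s)) d t ∧ d ≤ K * W (y, t))
    {t : ℝ} (ht : t ∈ Ico 0 T) {y : Y} (hy : y ∈ C) :
    W (y, t) ≤ c₀ * Real.exp ((K + 1) * t) := by
  by_contra! hlt
  -- The rate `K + 1` instead of `K` makes the time derivative of `Z` strictly negative at a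
  -- positive spatial maximum of `W`.
  set Z : Y × ℝ → ℝ := fun q => Real.exp (-((K + 1) * q.2)) * W q with hZ
  have hsub : C ×ˢ Icc 0 t ⊆ C ×ˢ Ico 0 T :=
    prod_mono le_rfl (Icc_subset_Ico_right ht.2)
  have hZc : ContinuousOn Z (C ×ˢ Icc 0 t) :=
    ContinuousOn.mul (by fun_prop) (hW.mono hsub)
  obtain ⟨⟨z, s⟩, ⟨hz, hs⟩, hmax⟩ := (hC.prod isCompact_Icc).exists_isMaxOn
    ⟨(y, t), hy, ht.1, le_rfl⟩ hZc
  simp only at hz hs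
  have hlarge : c₀ < Z (z, s) := by
    refine lt_of_lt_of_le ?_ (hmax ⟨hy, ht.1, le_rfl⟩)
    have := mul_lt_mul_of_pos_left hlt (Real.exp_pos (-((K + 1) * t)))
    rwa [mul_left_comm, ← Real.exp_add, neg_add_cancel, Real.exp_zero, mul_one] at this
  have hWpos : 0 < W (z, s) := by
    have : 0 < Z (z, s) := hc₀.trans_lt hlarge
    exact pos_of_mul_pos_right this (Real.exp_pos _).le
  have hs0 : 0 < s := by
    refine lt_of_le_of_ne hs.1 fun h => ?_
    rw [← h] at hlarge
    have := h0 z hz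
    simp only [hZ, mul_zero, neg_zero, Real.exp_zero, one_mul] at hlarge
    exact this.not_gt hlarge
  have hsp : IsMaxOn (fun w => W (w, s)) C z := fun w hw =>
    le_of_mul_le_mul_left (hmax (⟨hw, hs⟩ : (w, s) ∈ C ×ˢ Icc 0 t)) (Real.exp_pos _)
  obtain ⟨d, hWd, hdK⟩ := hd s ⟨hs0, hs.2.trans_lt ht.2⟩ z hz hsp hWpos
  have hZd : HasDerivAt (fun r => Z (z, r))
      (Real.exp (-((K + 1) * s)) * (d - (K + 1) * W (z, s))) s := by
    have h1 : HasDerivAt (fun r : ℝ => Real.exp (-((K + 1) * r)))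
        (Real.exp (-((K + 1) * s)) * -((K + 1) * 1)) s :=
      ((hasDerivAt_id s).const_mul (K + 1)).fun_neg.exp
    convert! h1.mul hWd using 1
    ring
  have hmaxt : IsMaxOn (fun r => Z (z, r)) (Icc 0 t) s := fun r hr =>
    hmax (⟨hz, hr⟩ : (z, r) ∈ C ×ˢ Icc 0 t)
  -- The maximum may sit at the right end `s = t`, so only the backward direction is tested; it is
  -- available because `s > 0`.
  have hcone : (0 : ℝ) - s ∈ posTangentConeAt (Icc 0 t) s :=
    sub_mem_posTangentConeAt_of_segment_subset
      ((convex_Icc 0 t).segment_subset hs ⟨le_rfl, ht.1⟩)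
  have hle := hmaxt.localize.hasFDerivWithinAt_nonpos hZd.hasFDerivAt.hasFDerivWithinAt hcone
  have hneg : Real.exp (-((K + 1) * s)) * (d - (K + 1) * W (z, s)) < 0 :=
    mul_neg_of_pos_of_neg (Real.exp_pos _) (by linarith)
  simp only [ContinuousLinearMap.toSpanSingleton_apply, smul_eq_mul, zero_sub] at hle
  nlinarith

/-! ### The solution along the flow -/

namespace MovingHypersurface

variable {n : ℕ} {T : ℝ} {M : MovingHypersurface n T} {t : ℝ} {y : Amb n}

theorem flow_mem (ht : t ∈ Icc 0 T) (hy : y ∈ M.Γ 0) : M.Φ (y, t) ∈ M.Γ t :=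
  (M.bijOn t ht).mapsTo hy

/-- The material derivative is the derivative along the trajectories of material points. -/
theorem hasDerivAt_flow_materialDeriv {u : Amb n × ℝ → ℝ} (hu : SmoothOnSet u M.spaceTime)
    (ht : t ∈ Ioo 0 T) (hy : y ∈ M.Γ 0) :
    HasDerivAt (fun s => u (M.Φ (y, s), s)) (M.materialDeriv u (M.Φ (y, t), t)) t := by
  have ht' := Ioo_subset_Icc_self ht
  have h1 : SmoothOnSet (fun s => M.Φ (y, s)) (Icc 0 T) :=
    M.smooth_Φ.comp_contDiff (contDiff_prodMk_right y) fun s hs => ⟨hy, hs⟩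
  obtain ⟨L, hL⟩ := h1.exists_hasFDerivWithinAt ht'
  have h2 : HasDerivAt (fun s => M.Φ (y, s)) (M.velocity (M.Φ (y, t), t)) t := by
    rw [velocity_eq, flowInv_flow ht' hy]
    exact hL.differentiableWithinAt.hasDerivWithinAt.hasDerivAt (Icc_mem_nhds ht.1 ht.2)
  obtain ⟨A, hA⟩ := hu.exists_hasFDerivWithinAt (x := (M.Φ (y, t), t)) ⟨ht, flow_mem ht' hy⟩
  have h3 := hA.differentiableWithinAt.hasFDerivWithinAt.comp_hasDerivWithinAt t
    (f := fun s => (M.Φ (y, s), s)) (s := Ioo 0 T) (h2.prodMk (hasDerivAt_id t)).hasDerivWithinAt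
    (fun s hs => ⟨hs, flow_mem (Ioo_subset_Icc_self hs) hy⟩)
  exact h3.hasDerivAt (Ioo_mem_nhds ht.1 ht.2)

theorem IsDiffusionMatrix.apply_mem_tangentSpaceAt {B : Amb n × ℝ → Amb n →L[ℝ] Amb n}
    (hB : M.IsDiffusionMatrix B) (ht : t ∈ Ioo 0 T) {x : Amb n} (hx : x ∈ M.Γ t) (a : Amb n) :
    B (x, t) a ∈ tangentSpaceAt (M.Γ t) x := by
  have h := hB.normal t ht x hx _
    ((tangentSpaceAt (M.Γ t) x).sub_starProjection_mem_orthogonal a)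
  rw [map_sub, sub_eq_zero] at h
  rw [h]
  exact hB.tangent t ht x hx _ (Submodule.starProjection_apply_mem _ _)

theorem slice_spaceTime (ht : t ∈ Ioo 0 T) :
    MapsTo (fun y : Amb n => (y, t)) (M.Γ t) M.spaceTime := fun _ hy => ⟨ht, hy⟩

section Solution

variable {f : Amb n × ℝ → ℝ → Amb n} {B : Amb n × ℝ → Amb n →L[ℝ] Amb n} {ε : ℝ}
  {u₀ : Amb n → ℝ} {u : Amb n × ℝ → ℝ} {x : Amb n}

/-- At a critical point of the solution only the diffusion and the expansion of the surface
contribute to the material derivative. -/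
theorem IsSmoothSolution.materialDeriv_eq (hf : M.IsFlux f) (hB : M.IsDiffusionMatrix B)
    (hu : M.IsSmoothSolution f B ε u₀ u) (ht : t ∈ Ioo 0 T) (hx : x ∈ M.Γ t)
    (h0 : tangentialGradient (M.Γ t) (fun z => u (z, t)) x = 0) {A : Amb n →L[ℝ] Amb n}
    (hA : HasFDerivWithinAt (tangentialGradient (M.Γ t) (fun z => u (z, t))) A (M.Γ t) x) :
    M.materialDeriv u (x, t) =
      -(u (x, t) * surfaceDiv (M.Γ t) (fun y => M.velocity (y, t)) x) +
        ε * LinearMap.trace ℝ (Amb n) (A ∘L B (x, t) : Amb n →L[ℝ] Amb n) := by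
  have hslice : ContDiff ℝ ∞ (fun y : Amb n => (y, t)) := contDiff_prodMk_left t
  have hus : SmoothOnSet (fun z => u (z, t)) (M.Γ t) :=
    hu.smooth.comp_contDiff hslice (slice_spaceTime ht)
  have hBs : SmoothOnSet (fun z => B (z, t)) (M.Γ t) :=
    hB.smooth.comp_contDiff hslice (slice_spaceTime ht)
  have hfs : SmoothOnSet (fun q : Amb n × ℝ => f (q.1, t) q.2) (M.Γ t ×ˢ univ) :=
    hf.smooth.comp_contDiff (ι := fun q : Amb n × ℝ => ((q.1, t), q.2))
      ((contDiff_fst.prodMk contDiff_const).prodMk contDiff_snd)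
      fun q hq => ⟨slice_spaceTime ht hq.1, trivial⟩
  have h1 := surfaceDiv_comp_of_tangentialGradient_eq_zero (F := fun y => f (y, t)) hfs hus hx h0
  have h2 := surfaceDiv_diffusion_eq_trace hBs hx hA h0
    (fun a => hB.apply_mem_tangentSpaceAt ht hx a)
  have h3 := hu.pde t ht x hx
  rw [h1, hf.div_free t ht _ x hx, h2] at h3
  linarith

theorem IsSmoothSolution.materialDeriv_le (hf : M.IsFlux f) (hB : M.IsDiffusionMatrix B)
    (hu : M.IsSmoothSolution f B ε u₀ u) (hε : 0 ≤ ε) (ht : t ∈ Ioo 0 T) (hx : x ∈ M.Γ t)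
    (hmax : IsMaxOn (fun z => u (z, t)) (M.Γ t) x) :
    M.materialDeriv u (x, t) ≤
      -(u (x, t) * surfaceDiv (M.Γ t) (fun y => M.velocity (y, t)) x) := by
  obtain ⟨U, φ, hxU, hφ⟩ :=
    (M.hypersurface t (Ioo_subset_Icc_self ht)).exists_isDefiningFunction hx
  have hus : SmoothOnSet (fun z => u (z, t)) (M.Γ t) :=
    hu.smooth.comp_contDiff (contDiff_prodMk_left t) (slice_spaceTime ht)
  obtain ⟨h0, A, hA, hAn⟩ := hφ.exists_hasFDerivWithinAt_tangentialGradient hxU hx hus hmax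
  rw [hu.materialDeriv_eq hf hB ht hx h0 hA]
  have := trace_comp_nonpos (hB.symmetric t ht x hx)
    (fun a => hB.apply_mem_tangentSpaceAt ht hx a) (hB.posDef t ht x hx) hAn
  nlinarith

/-- The first and second order conditions are applied to `-u`, but the equation is used for `u`
itself, so the flux need not be reflected. -/
theorem IsSmoothSolution.le_materialDeriv (hf : M.IsFlux f) (hB : M.IsDiffusionMatrix B)
    (hu : M.IsSmoothSolution f B ε u₀ u) (hε : 0 ≤ ε) (ht : t ∈ Ioo 0 T) (hx : x ∈ M.Γ t)
    (hmin : IsMinOn (fun z => u (z, t)) (M.Γ t) x) :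
    -(u (x, t) * surfaceDiv (M.Γ t) (fun y => M.velocity (y, t)) x) ≤
      M.materialDeriv u (x, t) := by
  obtain ⟨U, φ, hxU, hφ⟩ :=
    (M.hypersurface t (Ioo_subset_Icc_self ht)).exists_isDefiningFunction hx
  have hus : SmoothOnSet (fun z => u (z, t)) (M.Γ t) :=
    hu.smooth.comp_contDiff (contDiff_prodMk_left t) (slice_spaceTime ht)
  obtain ⟨h0, A, hA, hAn⟩ :=
    hφ.exists_hasFDerivWithinAt_tangentialGradient hxU hx hus.neg hmin.neg
  have hneg : ∀ z ∈ M.Γ t, tangentialGradient (M.Γ t) (fun z => u (z, t)) z =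
      -tangentialGradient (M.Γ t) (fun z => -u (z, t)) z := fun z hz => by
    obtain ⟨L, hL⟩ := hus.exists_hasFDerivWithinAt hz
    rw [tangentialGradient_neg hL, neg_neg]
  have hA' : HasFDerivWithinAt (tangentialGradient (M.Γ t) (fun z => u (z, t))) (-A) (M.Γ t) x :=
    hA.fun_neg.congr hneg (hneg x hx)
  rw [hu.materialDeriv_eq hf hB ht hx (by rw [hneg x hx, h0, neg_zero]) hA']
  have := trace_comp_nonpos (hB.symmetric t ht x hx)
    (fun a => hB.apply_mem_tangentSpaceAt ht hx a) (hB.posDef t ht x hx) hAn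
  have h1 : LinearMap.trace ℝ (Amb n) ((-A) ∘L B (x, t) : Amb n →L[ℝ] Amb n) =
      -LinearMap.trace ℝ (Amb n) (A ∘L B (x, t) : Amb n →L[ℝ] Amb n) := by
    rw [← map_neg]; rfl
  rw [h1]
  nlinarith

/-- An essential bound on the initial values holds everywhere, by continuity. -/
theorem IsSmoothSolution.abs_initial_le (hT : 0 < T) (hu : M.IsSmoothSolution f B ε u₀ u)
    {c₀ : ℝ≥0} (h : eLpNorm u₀ ∞ (surfaceMeasure (M.Γ 0)) ≤ c₀) (hx : x ∈ M.Γ 0) :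
    |u (x, 0)| ≤ c₀ := by
  by_contra! hlt
  have hS := M.hypersurface 0 ⟨le_rfl, hT.le⟩
  have hc : ContinuousOn (fun z => |u (z, 0)|) (M.Γ 0) :=
    (hu.continuousOn.comp (Continuous.prodMk_left (0 : ℝ)).continuousOn
      fun z hz => ⟨⟨le_rfl, hT⟩, hz⟩).abs
  obtain ⟨V, hV, hVs⟩ := mem_nhdsWithin_iff_exists_mem_nhds_inter.1
    ((hc x hx).eventually (lt_mem_nhds hlt))
  have hae : ∀ᵐ z ∂(surfaceMeasure (M.Γ 0)), ‖u₀ z‖ₑ ≤ c₀ := by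
    rw [eLpNorm_exponent_top] at h
    filter_upwards [ae_le_eLpNormEssSup (f := u₀) (μ := surfaceMeasure (M.Γ 0))] with z hz
      using hz.trans h
  rw [surfaceMeasure, ae_iff, Measure.restrict_apply' hS.isCompact.isClosed.measurableSet] at hae
  -- If the bound failed at `x`, it would fail on the relatively open piece `V ∩ Γ(0)`, which is not
  -- a null set.
  refine (hS.hausdorffMeasure_inter_pos hx hV).ne' (measure_mono_null ?_ hae)
  rintro z ⟨hzV, hz⟩
  refine ⟨?_, hz⟩
  have h1 : (c₀ : ℝ) < |u (z, 0)| := hVs ⟨hzV, hz⟩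
  rw [hu.initial z hz] at h1
  simp only [mem_ofPred_eq, not_le]
  rw [← ofReal_norm, Real.norm_eq_abs, ← ENNReal.ofReal_coe_nnreal]
  exact (ENNReal.ofReal_lt_ofReal_iff_of_nonneg c₀.2).2 h1

end Solution

end MovingHypersurface

open MovingHypersurface in
theorem mainTheorem4 (n : ℕ) (T : ℝ) (hT : 0 < T) (M : MovingHypersurface n T)
    (f : Amb n × ℝ → ℝ → Amb n) (hf : M.IsFlux f)
    (B : Amb n × ℝ → Amb n →L[ℝ] Amb n) (hB : M.IsDiffusionMatrix B) (c₀ : ℝ≥0) :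
    ∃ c : ℝ≥0, ∀ ε : ℝ, 0 < ε → ε ≤ 1 →
      ∀ (u₀ : Amb n → ℝ) (u : Amb n × ℝ → ℝ),
        eLpNorm u₀ ∞ (surfaceMeasure (M.Γ 0)) ≤ (c₀ : ℝ≥0∞) →
        M.IsSmoothSolution f B ε u₀ u →
        (⨆ t ∈ Ioo 0 T, eLpNorm (fun x => u (x, t)) ∞ (surfaceMeasure (M.Γ t))) ≤ (c : ℝ≥0∞) := by
  obtain ⟨K, hK, hKv⟩ := exists_abs_surfaceDiv_velocity_le (M := M) hT
  refine ⟨c₀ * (Real.exp ((K + 1) * T)).toNNReal, fun ε hε _ u₀ u hu₀ hu => ?_⟩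
  have hS := M.hypersurface 0 ⟨le_rfl, hT.le⟩
  have hc : ContinuousOn (fun q : Amb n × ℝ => u (M.Φ q, q.2)) (M.Γ 0 ×ˢ Ico 0 T) :=
    hu.continuousOn.comp ((M.smooth_Φ.continuousOn.mono
      (prod_mono le_rfl Ico_subset_Icc_self)).prodMk continuousOn_snd)
      fun q hq => ⟨hq.2, flow_mem (Ico_subset_Icc_self hq.2) hq.1⟩
  have h0 : ∀ y ∈ M.Γ 0, |u (M.Φ (y, 0), 0)| ≤ c₀ := fun y hy => by
    rw [M.Φ_zero y hy]
    exact hu.abs_initial_le hT hu₀ hy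
  -- By surjectivity of the flow, extremality over `Γ(0)` in flow coordinates is extremality over
  -- `Γ(t)`.
  have hext : ∀ {t : ℝ} {P : Amb n → Prop}, t ∈ Ioo 0 T → (∀ z ∈ M.Γ 0, P (M.Φ (z, t))) →
      ∀ x ∈ M.Γ t, P x := fun {t P} ht h x hx => by
    have ht' := Ioo_subset_Icc_self ht
    have := h _ (mapsTo_flowInv ht' hx)
    rwa [flow_flowInv ht' hx] at this
  have hupper : ∀ t ∈ Ico 0 T, ∀ y ∈ M.Γ 0,
      u (M.Φ (y, t), t) ≤ c₀ * Real.exp ((K + 1) * t) := fun t ht y hy =>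
    le_mul_exp_of_deriv_le_at_max (W := fun q => u (M.Φ q, q.2)) hS.isCompact c₀.2 hc
      (fun y hy => (abs_le.1 (h0 y hy)).2)
      (fun s hs z hz hmax hpos => by
        refine ⟨_, hasDerivAt_flow_materialDeriv hu.smooth hs hz, ?_⟩
        have hzs := flow_mem (Ioo_subset_Icc_self hs) hz
        have h1 := hu.materialDeriv_le hf hB hε.le hs hzs (hext hs hmax)
        have h2 := (abs_le.1 (hKv s (Ioo_subset_Icc_self hs) _ hzs)).1
        simp only at hpos ⊢
        nlinarith)
      ht hy
  have hlower : ∀ t ∈ Ico 0 T, ∀ y ∈ M.Γ 0,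
      -u (M.Φ (y, t), t) ≤ c₀ * Real.exp ((K + 1) * t) := fun t ht y hy =>
    le_mul_exp_of_deriv_le_at_max (W := fun q => -u (M.Φ q, q.2)) hS.isCompact c₀.2 hc.neg
      (fun y hy => neg_le.1 (abs_le.1 (h0 y hy)).1)
      (fun s hs z hz hmax hpos => by
        refine ⟨_, (hasDerivAt_flow_materialDeriv hu.smooth hs hz).fun_neg, ?_⟩
        have hzs := flow_mem (Ioo_subset_Icc_self hs) hz
        have h1 := hu.le_materialDeriv hf hB hε.le hs hzs
          (hext hs fun w hw => show u (M.Φ (z, s), s) ≤ u (M.Φ (w, s), s) from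
            neg_le_neg_iff.1 (hmax hw))
        have h2 := (abs_le.1 (hKv s (Ioo_subset_Icc_self hs) _ hzs)).1
        simp only at hpos ⊢
        nlinarith)
      ht hy
  refine iSup₂_le fun t ht => ?_
  have hbound : ∀ x ∈ M.Γ t, ‖u (x, t)‖₊ ≤ c₀ * (Real.exp ((K + 1) * T)).toNNReal := by
    refine hext ht fun z hz => ?_
    rw [← NNReal.coe_le_coe, coe_nnnorm, Real.norm_eq_abs, NNReal.coe_mul,
      Real.coe_toNNReal _ (Real.exp_pos _).le]
    have ht' := Ioo_subset_Ico_self ht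
    refine (abs_le'.2 ⟨hupper t ht' z hz, hlower t ht' z hz⟩).trans ?_
    have : t ≤ T := ht.2.le
    gcongr
  rw [eLpNorm_exponent_top]
  exact eLpNormEssSup_le_of_ae_nnnorm_bound (ae_restrict_of_forall_mem
    (M.hypersurface t (Ioo_subset_Icc_self ht)).isCompact.isClosed.measurableSet hbound)
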